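/- Let $B$ be the backward shift $B(x_1,x_2,x_3,\dots)=(x_2,x_3,\dots)$ on the complex Hilbert space $\ell^2(\mathbb{N})$, let $\lambda,a\in\mathbb{C}$ be non-zero, let $n\ge 0$ be an integer, and suppose that $T=\lambda I+aB^n$ is invertible in the algebra of bounded linear operators. Then each of the following four equivalences holds: $T$ is strongly mixing if and only if $T^{-1}$ is; $T$ is Devaney chaotic if and only if $T^{-1}$ is; $T$ is distributionally chaotic if and only if $T^{-1}$ is; $T$ is Li-Yorke chaotic if and only if $T^{-1}$ is. Here a bounded linear operator $S$ on a normed space $X$ is called (i) strongly mixing if for all non-empty open $U,V\subseteq X$ there is $N$ with $S^k(U)\cap V\neq\emptyset$ for all $k\ge N$; (ii) Devaney chaotic if for all non-empty open $U,V\subseteq X$ there is $k\geq 0$ with $S^k(U)\cap V\ne\emptyset$, the periodic points of $S$ are dense in $X$, and $S$ depends sensitively on initial conditions (there is $\delta>0$ such that for every $x\in X$ and $\varepsilon>0$ there are $y\in X$ and $k\ge 0$ with $\|y-x\|<\varepsilon$ and $\|S^ky-S^kx\|>\delta$); (iii) distributionally chaotic if there is $x\in X$ such that, with $F_x^m(\tau)=\frac1m\#\{0\le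 i\le m:\|S^ix\|<\tau\}$, one has $\liminf_{m\to\infty}F_x^m(\tau)=0$ for some $\tau>0$ and $\limsup_{m\to\infty}F_x^m(\varepsilon)=1$ for every $\varepsilon>0$; (iv) Li-Yorke chaotic if there is $x\in X$ with $\limsup_{k\to\infty}\|S^kx\|>0$ and $\liminf_{k\to\infty}\|S^kx\|=0$, the limits being taken in $[0,\infty]$. -/

import Mathlib

open Filter Topology

open scoped ENNReal

/-- The complex Hilbert space `ℓ²(ℕ)`. -/
abbrev SeqL2 : Type := lp (fun _ : ℕ => ℂ) 2

theorem SeqL2.memℓp_tail (x : SeqL2) : Memℓp (fun k : ℕ => x (k + 1)) 2 := by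
  have hx : Summable fun k : ℕ => ‖x k‖ ^ (2 : ℝ≥0∞).toReal :=
    (lp.memℓp x).summable (by norm_num)
  exact memℓp_gen ((summable_nat_add_iff 1).2 hx)

theorem SeqL2.norm_tail_le (x : SeqL2) :
    ‖(⟨fun k : ℕ => x (k + 1), SeqL2.memℓp_tail x⟩ : SeqL2)‖ ≤ ‖x‖ := by
  have h2 : 0 < (2 : ℝ≥0∞).toReal := by norm_num
  refine lp.norm_le_of_forall_sum_le h2 (norm_nonneg _) fun s => ?_
  have h := lp.sum_rpow_le_norm_rpow h2 x (s.map (addRightEmbedding 1))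
  rw [Finset.sum_map] at h
  exact h

/-- The backward shift `B (x₀, x₁, x₂, …) = (x₁, x₂, …)` on `ℓ²(ℕ)`. -/
noncomputable def backwardShift : SeqL2 →L[ℂ] SeqL2 :=
  LinearMap.mkContinuous
    { toFun := fun x => ⟨fun k : ℕ => x (k + 1), SeqL2.memℓp_tail x⟩
      map_add' := fun _ _ => rfl
      map_smul' := fun _ _ => rfl }
    1 (fun x => (SeqL2.norm_tail_le x).trans_eq (one_mul ‖x‖).symm)

theorem backwardShift_apply (x : SeqL2) (k : ℕ) : backwardShift x k = x (k + 1) := rfl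

section Dynamics

variable {E : Type*} [NormedAddCommGroup E] [NormedSpace ℂ E]

/-- `T` is (topologically) strongly mixing: for all non-empty open `U`, `V` there is `N` such that
`Tⁿ(U)` meets `V` for every `n ≥ N`. -/
def IsStronglyMixing (T : E →L[ℂ] E) : Prop :=
  ∀ U V : Set E, IsOpen U → U.Nonempty → IsOpen V → V.Nonempty →
    ∃ N : ℕ, ∀ n ≥ N, (((T ^ n : E →L[ℂ] E) '' U) ∩ V).Nonempty

/-- `T` is topologically transitive: for all non-empty open `U`, `V` some `Tⁿ(U)` meets `V`. -/
def IsTransitiveOperator (T : E →L[ℂ] E) : Prop :=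
  ∀ U V : Set E, IsOpen U → U.Nonempty → IsOpen V → V.Nonempty →
    ∃ n : ℕ, (((T ^ n : E →L[ℂ] E) '' U) ∩ V).Nonempty

/-- Sensitive dependence on initial conditions. -/
def HasSensitiveDependence (T : E →L[ℂ] E) : Prop :=
  ∃ δ > 0, ∀ x : E, ∀ ε > 0, ∃ y : E, ‖y - x‖ < ε ∧ ∃ n : ℕ, δ < ‖(T ^ n) y - (T ^ n) x‖

/-- `T` is Devaney chaotic: it is topologically transitive, its periodic points are dense, and it
depends sensitively on initial conditions. -/
def IsDevaneyChaotic (T : E →L[ℂ] E) : Prop :=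
  IsTransitiveOperator T ∧ Dense (Function.periodicPts T) ∧ HasSensitiveDependence T

/-- `T` is Li-Yorke chaotic: some `x` has `limsup ‖Tⁿ x‖ > 0` and `liminf ‖Tⁿ x‖ = 0`. The limits
are taken in `[0, ∞]`, since the orbit may be unbounded. -/
def IsLiYorkeChaotic (T : E →L[ℂ] E) : Prop :=
  ∃ x : E, 0 < limsup (fun n : ℕ => ‖(T ^ n) x‖ₑ) atTop ∧
    liminf (fun n : ℕ => ‖(T ^ n) x‖ₑ) atTop = 0

/-- `Fₓⁿ(τ) = (1/n) · #{0 ≤ i ≤ n : ‖Tⁱ x‖ < τ}`. -/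
noncomputable def orbitDistribution (T : E →L[ℂ] E) (x : E) (n : ℕ) (τ : ℝ) : ℝ :=
  (1 / (n : ℝ)) * (((Finset.range (n + 1)).filter fun i => ‖(T ^ i) x‖ < τ).card : ℝ)

/-- The values of the distribution functions lie in `[0, 2]`, so that the real `liminf` and
`limsup` below are the true ones. -/
theorem orbitDistribution_mem_Icc (T : E →L[ℂ] E) (x : E) (n : ℕ) (τ : ℝ) :
    orbitDistribution T x n τ ∈ Set.Icc (0 : ℝ) 2 := by
  refine ⟨by unfold orbitDistribution; positivity, ?_⟩
  unfold orbitDistribution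
  rcases Nat.eq_zero_or_pos n with rfl | hn
  · simp
  · have h1 : (((Finset.range (n + 1)).filter fun i => ‖(T ^ i) x‖ < τ).card : ℝ) ≤ n + 1 := by
      exact_mod_cast (Finset.card_filter_le _ _).trans (Finset.card_range _).le
    have h2 : (1 : ℝ) ≤ n := by exact_mod_cast hn
    rw [one_div, inv_mul_le_iff₀ (by positivity)]
    linarith

/-- `Fₓ(τ) = liminf Fₓⁿ(τ)`. -/
noncomputable def lowerOrbitDistribution (T : E →L[ℂ] E) (x : E) (τ : ℝ) : ℝ :=
  liminf (fun n : ℕ => orbitDistribution T x n τ) atTop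

/-- `Fₓ*(τ) = limsup Fₓⁿ(τ)`. -/
noncomputable def upperOrbitDistribution (T : E →L[ℂ] E) (x : E) (τ : ℝ) : ℝ :=
  limsup (fun n : ℕ => orbitDistribution T x n τ) atTop

/-- `T` is distributionally chaotic: there is an `x` with `Fₓ(τ) = 0` for some `τ > 0` and
`Fₓ*(ε) = 1` for all `ε > 0`. -/
def IsDistributionallyChaotic (T : E →L[ℂ] E) : Prop :=
  ∃ x : E, (∃ τ > 0, lowerOrbitDistribution T x τ = 0) ∧
    ∀ ε > 0, upperOrbitDistribution T x ε = 1

end Dynamics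

/-! ### Distribution functions of orbits, and distributional chaos from long time windows. -/

section OrbitDistribution

variable {E : Type*} [NormedAddCommGroup E] [NormedSpace ℂ E]

/-! Write `T = λ + aBⁿ`. For `‖z‖ < 1` the sequence `(1, z, z², …)` is an eigenvector of `T` with
eigenvalue `λ + azⁿ`, so for `n ≥ 1` these eigenvalues fill the open disc `D` of centre `λ` and
radius `‖a‖`.

If `D` misses the unit circle, then `‖λ‖ + ‖a‖ ≤ 1` or `1 + ‖a‖ ≤ ‖λ‖`: one of `T`, `T⁻¹` never
increases norms and the other never decreases them. Orbit norms are then monotone, so neither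
operator is transitive or Li-Yorke chaotic, and all four properties fail for both
(`chaos_iff_of_not`). The scalar case `n = 0` is of this kind.

If `D` meets the circle at `w`, then points inside the circle, points outside it and roots of unity
all accumulate at `w`. Each of these three sets of eigenvalues has eigenvectors with dense span
(`dense_eigenvectorSpan_of_frequently`, by the identity theorem), and the Godefroy-Shapiro argument
gives all four properties (`chaos_of_dense_eigenvectorSpan`). The inverse has the same eigenvectors
with inverted eigenvalues; inversion swaps inside and outside and keeps roots of unity, so `T⁻¹` has
all four properties too. -/

theorem isBoundedUnder_le_orbitDistribution (T : E →L[ℂ] E) (x : E) (τ : ℝ) :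
    IsBoundedUnder (· ≤ ·) atTop fun m => orbitDistribution T x m τ :=
  isBoundedUnder_of ⟨2, fun m => (orbitDistribution_mem_Icc T x m τ).2⟩

theorem isBoundedUnder_ge_orbitDistribution (T : E →L[ℂ] E) (x : E) (τ : ℝ) :
    IsBoundedUnder (· ≥ ·) atTop fun m => orbitDistribution T x m τ :=
  isBoundedUnder_of ⟨0, fun m => (orbitDistribution_mem_Icc T x m τ).1⟩

theorem orbitDistribution_le_of_forall_le {T : E →L[ℂ] E} {x : E} {τ : ℝ} {N m : ℕ}
    (h : ∀ i, N ≤ i → i ≤ m → τ ≤ ‖(T ^ i) x‖) : orbitDistribution T x m τ ≤ (N : ℝ) / m := by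
  have hsub : (Finset.range (m + 1)).filter (fun i => ‖(T ^ i) x‖ < τ) ⊆ Finset.range N := by
    intro i hi
    rw [Finset.mem_filter, Finset.mem_range] at hi
    rw [Finset.mem_range]
    by_contra hN
    exact (h i (by omega) (by omega)).not_gt hi.2
  have hcard := Finset.card_le_card hsub
  rw [Finset.card_range] at hcard
  rw [orbitDistribution, one_div_mul_eq_div]
  gcongr

theorem le_orbitDistribution_of_forall_lt {T : E →L[ℂ] E} {x : E} {τ : ℝ} {N m : ℕ}
    (h : ∀ i, N ≤ i → i ≤ m → ‖(T ^ i) x‖ < τ) :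
    ((m : ℝ) - N) / m ≤ orbitDistribution T x m τ := by
  have hsub : Finset.Ico N (m + 1) ⊆ (Finset.range (m + 1)).filter fun i => ‖(T ^ i) x‖ < τ := by
    intro i hi
    rw [Finset.mem_Ico] at hi
    rw [Finset.mem_filter, Finset.mem_range]
    exact ⟨hi.2, h i hi.1 (by omega)⟩
  have hcard := Finset.card_le_card hsub
  rw [Nat.card_Ico] at hcard
  rw [orbitDistribution, one_div_mul_eq_div]
  gcongr
  rw [sub_le_iff_le_add]
  exact_mod_cast (by omega : m ≤ _ + N)

/-- The count runs over `m + 1` indices but is divided by `m`, so 1 is a bound only in the limit. -/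
theorem orbitDistribution_le (T : E →L[ℂ] E) (x : E) (m : ℕ) (τ : ℝ) :
    orbitDistribution T x m τ ≤ ((m : ℝ) + 1) / m := by
  have h : orbitDistribution T x m τ ≤ ((m + 1 : ℕ) : ℝ) / m :=
    -- With `N = m + 1` the condition on the indices is vacuous.
    orbitDistribution_le_of_forall_le fun i h1 h2 => by omega
  exact_mod_cast h

theorem tendsto_add_one_div_self : Tendsto (fun m : ℕ => ((m : ℝ) + 1) / m) atTop (𝓝 1) := by
  have h : Tendsto (fun m : ℕ => 1 + 1 / (m : ℝ)) atTop (𝓝 (1 + 0)) :=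
    tendsto_const_nhds.add tendsto_one_div_atTop_nhds_zero_nat
  rw [add_zero] at h
  refine h.congr' ?_
  filter_upwards [eventually_gt_atTop 0] with m hm
  have : (m : ℝ) ≠ 0 := by positivity
  field_simp

theorem tendsto_sub_div_self (N : ℕ) :
    Tendsto (fun m : ℕ => ((m : ℝ) - N) / m) atTop (𝓝 1) := by
  have h : Tendsto (fun m : ℕ => 1 - (N : ℝ) / (m : ℝ)) atTop (𝓝 (1 - 0)) :=
    tendsto_const_nhds.sub (tendsto_const_div_atTop_nhds_zero_nat _)
  rw [sub_zero] at h
  refine h.congr' ?_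
  filter_upwards [eventually_gt_atTop 0] with m hm
  have : (m : ℝ) ≠ 0 := by positivity
  field_simp

theorem frequently_norm_lt_of_upperOrbitDistribution_eq_one {T : E →L[ℂ] E} {x : E} {ε : ℝ}
    (h : upperOrbitDistribution T x ε = 1) : ∃ᶠ k in atTop, ‖(T ^ k) x‖ < ε := by
  intro hev
  obtain ⟨N, hN⟩ := eventually_atTop.1 hev
  have ht : Tendsto (fun m => orbitDistribution T x m ε) atTop (𝓝 0) :=
    squeeze_zero (fun m => (orbitDistribution_mem_Icc T x m ε).1)
      (fun m => orbitDistribution_le_of_forall_le fun i hi _ => not_lt.1 (hN i hi))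
      (tendsto_const_div_atTop_nhds_zero_nat (N : ℝ))
  rw [upperOrbitDistribution, ht.limsup_eq] at h
  exact zero_ne_one h

theorem frequently_le_norm_of_lowerOrbitDistribution_eq_zero {T : E →L[ℂ] E} {x : E} {τ : ℝ}
    (h : lowerOrbitDistribution T x τ = 0) : ∃ᶠ k in atTop, τ ≤ ‖(T ^ k) x‖ := by
  intro hev
  obtain ⟨N, hN⟩ := eventually_atTop.1 hev
  have ht : Tendsto (fun m => orbitDistribution T x m τ) atTop (𝓝 1) :=
    tendsto_of_tendsto_of_tendsto_of_le_of_le (tendsto_sub_div_self N) tendsto_add_one_div_self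
      (fun m => le_orbitDistribution_of_forall_lt fun i hi _ => not_le.1 (hN i hi))
      (fun m => orbitDistribution_le T x m τ)
  rw [lowerOrbitDistribution, ht.liminf_eq] at h
  exact one_ne_zero h

theorem IsDistributionallyChaotic.isLiYorkeChaotic {T : E →L[ℂ] E}
    (h : IsDistributionallyChaotic T) : IsLiYorkeChaotic T := by
  obtain ⟨x, ⟨τ, hτ, hlow⟩, hup⟩ := h
  refine ⟨x, ?_, ?_⟩
  · refine (ENNReal.ofReal_pos.2 hτ).trans_le (le_limsup_of_frequently_le ?_)
    refine (frequently_le_norm_of_lowerOrbitDistribution_eq_zero hlow).mono fun k hk => ?_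
    rw [← ofReal_norm]
    exact ENNReal.ofReal_le_ofReal hk
  · by_contra hne
    obtain ⟨c, hc0, hc⟩ := ENNReal.lt_iff_exists_real_btwn.1 (pos_iff_ne_zero.2 hne)
    obtain ⟨hc1, hc2⟩ := hc
    refine frequently_norm_lt_of_upperOrbitDistribution_eq_one
      (hup c (ENNReal.ofReal_pos.1 hc1)) ?_
    filter_upwards [eventually_lt_of_lt_liminf hc2] with k hk hlt
    rw [← ofReal_norm] at hk
    exact hk.not_ge (ENNReal.ofReal_le_ofReal hlt.le)

/-- The times before `j` make up a fraction `1 / j` of those up to `j * j`, so a window `[j, j * j]`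
of small or large norms alone decides the distribution at time `j * j`, up to an error tending to 0.
-/
theorem isDistributionallyChaotic_of_forall_exists_window {T : E →L[ℂ] E} {x : E}
    (hsmall : ∀ m : ℕ, ∃ j ≥ m, ∀ i ∈ Set.Icc j (j * j), ‖(T ^ i) x‖ < 1 / ((m : ℝ) + 1))
    (hlarge : ∀ m : ℕ, ∃ j ≥ m, ∀ i ∈ Set.Icc j (j * j), 1 < ‖(T ^ i) x‖) :
    IsDistributionallyChaotic T := by
  refine ⟨x, ⟨1, one_pos, ?_⟩, fun ε hε => ?_⟩
  · refine le_antisymm (le_of_forall_pos_le_add fun δ hδ => ?_)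
      (le_liminf_of_le (isBoundedUnder_le_orbitDistribution T x 1).isCoboundedUnder_ge
        (.of_forall fun m => (orbitDistribution_mem_Icc T x m 1).1))
    refine liminf_le_of_frequently_le (frequently_atTop.2 fun M => ?_)
      (isBoundedUnder_ge_orbitDistribution T x 1)
    obtain ⟨K, hK⟩ := exists_nat_gt (1 / δ)
    obtain ⟨j, hj, hi⟩ := hlarge (max M (K + 1))
    have hj0 : 0 < j := by omega
    refine ⟨j * j, ?_, ?_⟩
    · exact (by omega : M ≤ j).trans (Nat.le_mul_self j)
    · refine (orbitDistribution_le_of_forall_le fun i h1 h2 => (hi i ⟨h1, h2⟩).le).trans ?_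
      have hKj : (K : ℝ) ≤ j := by exact_mod_cast (by omega : K ≤ j)
      have hj0' : (0 : ℝ) < j := by exact_mod_cast hj0
      rw [zero_add, Nat.cast_mul, div_mul_cancel_left₀ hj0'.ne', inv_le_comm₀ hj0' hδ, ← one_div]
      exact hK.le.trans hKj
  · have hone : Tendsto (fun m : ℕ => ((m : ℝ) + 1) / m) atTop (𝓝 1) := tendsto_add_one_div_self
    refine le_antisymm ?_ (le_of_forall_pos_le_add fun δ hδ => ?_)
    · rw [← hone.limsup_eq]
      exact limsup_le_limsup (.of_forall fun m => orbitDistribution_le T x m ε)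
        (isBoundedUnder_ge_orbitDistribution T x ε).isCoboundedUnder_le hone.isBoundedUnder_le
    · rw [← sub_le_iff_le_add]
      refine le_limsup_of_frequently_le (frequently_atTop.2 fun M => ?_)
        (isBoundedUnder_le_orbitDistribution T x ε)
      obtain ⟨K, hK⟩ := exists_nat_gt (1 / δ)
      obtain ⟨L, hL⟩ := exists_nat_gt (1 / ε)
      obtain ⟨j, hj, hi⟩ := hsmall (max (max M L) (K + 1))
      have hj0 : 0 < j := by omega
      have hKj : (K : ℝ) ≤ j := by exact_mod_cast (by omega : K ≤ j)
      have hj0' : (0 : ℝ) < j := by exact_mod_cast hj0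
      refine ⟨j * j, (by omega : M ≤ j).trans (Nat.le_mul_self j), ?_⟩
      refine le_trans ?_ (le_orbitDistribution_of_forall_lt (N := j) fun i h1 h2 =>
        (hi i ⟨h1, h2⟩).trans_le ?_)
      · rw [Nat.cast_mul, sub_div, div_self (by positivity), div_mul_cancel_left₀ hj0'.ne']
        have : (j : ℝ)⁻¹ ≤ δ := by
          rw [inv_le_comm₀ hj0' hδ, ← one_div]
          exact hK.le.trans hKj
        linarith
      · rw [one_div_le (by positivity) hε]
        have : (L : ℝ) ≤ (max (max M L) (K + 1) : ℕ) := by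
          exact_mod_cast (by omega : L ≤ max (max M L) (K + 1))
        linarith

end OrbitDistribution

/-! ### Operators with monotone orbit norms are not chaotic. -/

section NormMonotone

variable {E : Type*} [NormedAddCommGroup E] [NormedSpace ℂ E]

theorem antitone_norm_pow_apply {T : E →L[ℂ] E} (h : ∀ x, ‖T x‖ ≤ ‖x‖) (x : E) :
    Antitone fun k : ℕ => ‖(T ^ k) x‖ :=
  antitone_nat_of_succ_le fun k => by rw [pow_succ']; exact h _

theorem monotone_norm_pow_apply {T : E →L[ℂ] E} (h : ∀ x, ‖x‖ ≤ ‖T x‖) (x : E) :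
    Monotone fun k : ℕ => ‖(T ^ k) x‖ :=
  monotone_nat_of_le_succ fun k => by rw [pow_succ']; exact h _

/-- Monotone orbit norms converge in `[0, ∞]`, so their limsup and liminf agree. -/
theorem not_isLiYorkeChaotic_of_norm_le {T : E →L[ℂ] E} (h : ∀ x, ‖T x‖ ≤ ‖x‖) :
    ¬ IsLiYorkeChaotic T := by
  rintro ⟨x, hsup, hinf⟩
  have hanti : Antitone fun k : ℕ => ‖(T ^ k) x‖ₑ := fun i j hij => by
    simpa only [← ofReal_norm] using
      ENNReal.ofReal_le_ofReal (antitone_norm_pow_apply h x hij)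
  have ht := tendsto_atTop_iInf hanti
  rw [ht.limsup_eq, ← ht.liminf_eq, hinf] at hsup
  exact hsup.false

theorem not_isLiYorkeChaotic_of_le_norm {T : E →L[ℂ] E} (h : ∀ x, ‖x‖ ≤ ‖T x‖) :
    ¬ IsLiYorkeChaotic T := by
  rintro ⟨x, hsup, hinf⟩
  have hmono : Monotone fun k : ℕ => ‖(T ^ k) x‖ₑ := fun i j hij => by
    simpa only [← ofReal_norm] using
      ENNReal.ofReal_le_ofReal (monotone_norm_pow_apply h x hij)
  have ht := tendsto_atTop_iSup hmono
  rw [ht.limsup_eq, ← ht.liminf_eq, hinf] at hsup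
  exact hsup.false

theorem not_isTransitiveOperator_of_norm_le [Nontrivial E] {T : E →L[ℂ] E}
    (h : ∀ x, ‖T x‖ ≤ ‖x‖) : ¬ IsTransitiveOperator T := by
  intro hT
  obtain ⟨v, hv⟩ := NormedSpace.exists_lt_norm ℂ E 1
  obtain ⟨k, _, ⟨u, hu, rfl⟩, hk⟩ := hT {x | ‖x‖ < 1} {x | 1 < ‖x‖}
    (isOpen_lt continuous_norm continuous_const) ⟨0, by simp⟩
    (isOpen_lt continuous_const continuous_norm) ⟨v, hv⟩
  have := antitone_norm_pow_apply h u (Nat.zero_le k)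
  simp only [pow_zero, one_apply_eq_self, Set.mem_ofPred_eq] at this hu hk
  linarith

theorem not_isTransitiveOperator_of_le_norm [Nontrivial E] {T : E →L[ℂ] E}
    (h : ∀ x, ‖x‖ ≤ ‖T x‖) : ¬ IsTransitiveOperator T := by
  intro hT
  obtain ⟨v, hv⟩ := NormedSpace.exists_lt_norm ℂ E 1
  obtain ⟨k, _, ⟨u, hu, rfl⟩, hk⟩ := hT {x | 1 < ‖x‖} {x | ‖x‖ < 1}
    (isOpen_lt continuous_const continuous_norm) ⟨v, hv⟩
    (isOpen_lt continuous_norm continuous_const) ⟨0, by simp⟩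
  have := monotone_norm_pow_apply h u (Nat.zero_le k)
  simp only [pow_zero, one_apply_eq_self, Set.mem_ofPred_eq] at this hu hk
  linarith

theorem IsStronglyMixing.isTransitiveOperator {T : E →L[ℂ] E} (h : IsStronglyMixing T) :
    IsTransitiveOperator T := fun U V hU hU' hV hV' =>
  let ⟨N, hN⟩ := h U V hU hU' hV hV'
  ⟨N, hN N le_rfl⟩

/-- Each of the four chaos notions implies transitivity or Li-Yorke chaos, so all of them fail
together with these two. -/
theorem chaos_iff_of_not {S T : E →L[ℂ] E} (hS : ¬ IsTransitiveOperator S)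
    (hS' : ¬ IsLiYorkeChaotic S) (hT : ¬ IsTransitiveOperator T) (hT' : ¬ IsLiYorkeChaotic T) :
    (IsStronglyMixing S ↔ IsStronglyMixing T) ∧ (IsDevaneyChaotic S ↔ IsDevaneyChaotic T) ∧
      (IsDistributionallyChaotic S ↔ IsDistributionallyChaotic T) ∧
      (IsLiYorkeChaotic S ↔ IsLiYorkeChaotic T) :=
  ⟨iff_of_false (fun h => hS h.isTransitiveOperator) fun h => hT h.isTransitiveOperator,
    iff_of_false (fun h => hS h.1) fun h => hT h.1,
    iff_of_false (fun h => hS' h.isLiYorkeChaotic) fun h => hT' h.isLiYorkeChaotic,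
    iff_of_false hS' hT'⟩

end NormMonotone

/-! ### Chaos from dense spans of eigenvectors. -/

section GodefroyShapiro

variable {E : Type*} [NormedAddCommGroup E] [NormedSpace ℂ E]

/-- The span of the eigenvectors of `T` whose eigenvalue satisfies `P`. -/
def eigenvectorSpan (T : E →L[ℂ] E) (P : ℂ → Prop) : Submodule ℂ E :=
  Submodule.span ℂ {x | ∃ μ, P μ ∧ T x = μ • x}

theorem pow_apply_of_eigenvector {T : E →L[ℂ] E} {μ : ℂ} {x : E} (h : T x = μ • x) (k : ℕ) :
    (T ^ k) x = μ ^ k • x := by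
  induction k with
  | zero => simp
  | succ k ih =>
    rw [pow_succ', mul_apply_eq_comp, ih, map_smul, h, smul_smul, ← pow_succ]

theorem tendsto_pow_apply_of_mem_eigenvectorSpan {T : E →L[ℂ] E} {u : E}
    (hu : u ∈ eigenvectorSpan T fun μ => ‖μ‖ < 1) :
    Tendsto (fun k : ℕ => (T ^ k) u) atTop (𝓝 0) := by
  induction hu using Submodule.span_induction with
  | mem x hx =>
    obtain ⟨μ, hμ, hx⟩ := hx
    simp only [pow_apply_of_eigenvector hx]
    simpa using (tendsto_pow_atTop_nhds_zero_iff_norm_lt_one.2 hμ).smul_const x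
  | zero => simp
  | add x y _ _ hx hy => simpa using hx.add hy
  | smul a x _ hx => simpa using hx.const_smul a

/-- On an eigenvector, dividing by `μ ^ k` undoes `T ^ k`, and this tends to 0 when `1 < ‖μ‖`; sums
and multiples inherit such backward orbits. -/
theorem exists_tendsto_pow_apply_eq_of_mem_eigenvectorSpan {T : E →L[ℂ] E} {v : E}
    (hv : v ∈ eigenvectorSpan T fun μ => 1 < ‖μ‖) :
    ∃ w : ℕ → E, Tendsto w atTop (𝓝 0) ∧ ∀ k, (T ^ k) (w k) = v := by
  induction hv using Submodule.span_induction with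
  | mem x hx =>
    obtain ⟨μ, hμ, hx⟩ := hx
    have hμ0 : μ ≠ 0 := norm_pos_iff.1 (one_pos.trans hμ)
    refine ⟨fun k => μ⁻¹ ^ k • x, ?_, fun k => ?_⟩
    · have : ‖μ⁻¹‖ < 1 := by rw [norm_inv]; exact inv_lt_one_of_one_lt₀ hμ
      simpa using (tendsto_pow_atTop_nhds_zero_iff_norm_lt_one.2 this).smul_const x
    · rw [map_smul, pow_apply_of_eigenvector hx, smul_smul, ← mul_pow, inv_mul_cancel₀ hμ0,
        one_pow, one_smul]
  | zero => exact ⟨fun _ => 0, tendsto_const_nhds, fun k => map_zero _⟩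
  | add x y _ _ hx hy =>
    obtain ⟨w, hw, hw'⟩ := hx
    obtain ⟨z, hz, hz'⟩ := hy
    exact ⟨fun k => w k + z k, by simpa using hw.add hz, fun k => by rw [map_add, hw', hz']⟩
  | smul a x _ hx =>
    obtain ⟨w, hw, hw'⟩ := hx
    exact ⟨fun k => a • w k, by simpa using hw.const_smul a, fun k => by rw [map_smul, hw']⟩

theorem mem_periodicPts_of_mem_eigenvectorSpan {T : E →L[ℂ] E} {u : E}
    (hu : u ∈ eigenvectorSpan T fun μ => ∃ k > 0, μ ^ k = 1) : u ∈ Function.periodicPts T := by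
  suffices h : ∃ k > 0, (T ^ k) u = u by
    obtain ⟨k, hk, h⟩ := h
    refine ⟨k, hk, ?_⟩
    rwa [Function.IsPeriodicPt, Function.IsFixedPt, ← FunLike.coe_pow_eq_iterate]
  induction hu using Submodule.span_induction with
  | mem x hx =>
    obtain ⟨μ, ⟨k, hk, hμ⟩, hx⟩ := hx
    exact ⟨k, hk, by rw [pow_apply_of_eigenvector hx, hμ, one_smul]⟩
  | zero => exact ⟨1, one_pos, map_zero _⟩
  | add x y _ _ hx hy =>
    have hiter : ∀ (k l : ℕ) (z : E), (T ^ k) z = z → (T ^ (k * l)) z = z := by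
      intro k l z hz
      -- A fixed vector of `T ^ k` is an eigenvector of `T ^ k` with eigenvalue 1.
      rw [pow_mul, pow_apply_of_eigenvector (μ := 1) (by rwa [one_smul]), one_pow, one_smul]
    obtain ⟨k, hk, hx⟩ := hx
    obtain ⟨l, hl, hy⟩ := hy
    refine ⟨k * l, mul_pos hk hl, ?_⟩
    rw [map_add, hiter k l x hx, mul_comm, hiter l k y hy]
  | smul a x _ hx =>
    obtain ⟨k, hk, hx⟩ := hx
    exact ⟨k, hk, by rw [map_smul, hx]⟩

/-- The point `u + w k` is close to `u`, while its image `(T ^ k) u + v` is close to `v`. -/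
theorem isStronglyMixing_of_dense_eigenvectorSpan {T : E →L[ℂ] E}
    (h0 : Dense (eigenvectorSpan T fun μ => ‖μ‖ < 1 : Set E))
    (h1 : Dense (eigenvectorSpan T fun μ => 1 < ‖μ‖ : Set E)) : IsStronglyMixing T := by
  intro U V hU hU' hV hV'
  obtain ⟨u, hu, huU⟩ := h0.exists_mem_open hU hU'
  obtain ⟨v, hv, hvV⟩ := h1.exists_mem_open hV hV'
  obtain ⟨w, hw, hwv⟩ := exists_tendsto_pow_apply_eq_of_mem_eigenvectorSpan hv
  have hU1 : Tendsto (fun k => u + w k) atTop (𝓝 u) := by simpa using hw.const_add u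
  have hV1 : Tendsto (fun k : ℕ => (T ^ k) u + v) atTop (𝓝 v) := by
    simpa using (tendsto_pow_apply_of_mem_eigenvectorSpan hu).add_const v
  obtain ⟨N, hN⟩ := eventually_atTop.1
    ((hU1.eventually_mem (hU.mem_nhds huU)).and (hV1.eventually_mem (hV.mem_nhds hvV)))
  refine ⟨N, fun k hk => ⟨(T ^ k) (u + w k), ⟨_, (hN k hk).1, rfl⟩, ?_⟩⟩
  rw [map_add, hwv]
  exact (hN k hk).2

theorem exists_tendsto_norm_pow_apply_atTop [Nontrivial E] {T : E →L[ℂ] E}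
    (h1 : Dense (eigenvectorSpan T fun μ => 1 < ‖μ‖ : Set E)) :
    ∃ e : E, Tendsto (fun k : ℕ => ‖(T ^ k) e‖) atTop atTop := by
  have hex : ∃ e : E, e ≠ 0 ∧ ∃ μ : ℂ, 1 < ‖μ‖ ∧ T e = μ • e := by
    by_contra hne
    have hbot : eigenvectorSpan T (fun μ => 1 < ‖μ‖) = ⊥ :=
      Submodule.span_eq_bot.2 fun x hx => by
        by_contra hx0
        exact hne ⟨x, hx0, hx⟩
    rw [hbot, Submodule.bot_coe, dense_iff_closure_eq, closure_singleton] at h1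
    obtain ⟨x, hx⟩ := exists_ne (0 : E)
    exact hx (h1.symm.subset (Set.mem_univ x))
  obtain ⟨e, he, μ, hμ, hT⟩ := hex
  refine ⟨e, ?_⟩
  simp only [pow_apply_of_eigenvector hT, norm_smul, norm_pow]
  exact (tendsto_pow_atTop_atTop_of_one_lt hμ).atTop_mul_const (norm_pos_iff.2 he)

theorem tendsto_norm_pow_smul_apply_atTop {T : E →L[ℂ] E} {e : E}
    (he : Tendsto (fun k : ℕ => ‖(T ^ k) e‖) atTop atTop) {c : ℂ} (hc : c ≠ 0) :
    Tendsto (fun k : ℕ => ‖(T ^ k) (c • e)‖) atTop atTop := by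
  simp only [map_smul, norm_smul]
  exact he.const_mul_atTop (norm_pos_iff.2 hc)

theorem exists_ne_zero_norm_smul_lt (e : E) {ε : ℝ} (hε : 0 < ε) :
    ∃ c : ℂ, c ≠ 0 ∧ ‖c • e‖ < ε := by
  have h : Tendsto (fun c : ℂ => ‖c • e‖) (𝓝[≠] 0) (𝓝 0) := by
    have : Continuous fun c : ℂ => ‖c • e‖ := by fun_prop
    simpa using (this.tendsto 0).mono_left nhdsWithin_le_nhds
  obtain ⟨c, hc, hc'⟩ := ((h.eventually_lt_const hε).and self_mem_nhdsWithin).exists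
  exact ⟨c, hc', hc⟩

theorem hasSensitiveDependence_of_tendsto_atTop {T : E →L[ℂ] E} {e : E}
    (he : Tendsto (fun k : ℕ => ‖(T ^ k) e‖) atTop atTop) : HasSensitiveDependence T := by
  refine ⟨1, one_pos, fun x ε hε => ?_⟩
  obtain ⟨c, hc, hcε⟩ := exists_ne_zero_norm_smul_lt e hε
  obtain ⟨k, hk⟩ := ((tendsto_norm_pow_smul_apply_atTop he hc).eventually_gt_atTop 1).exists
  exact ⟨x + c • e, by rwa [add_sub_cancel_left], k, by rwa [map_add, add_sub_cancel_left]⟩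

/-- Baire category: for each `m`, having a window of small norms beyond `m` is an open dense
condition, and so is having one of large norms. A generic `x` satisfies all of them. -/
theorem isDistributionallyChaotic_of_dense [CompleteSpace E] {T : E →L[ℂ] E}
    (h0 : Dense {x : E | Tendsto (fun k : ℕ => (T ^ k) x) atTop (𝓝 0)})
    (h1 : Dense {x : E | Tendsto (fun k : ℕ => ‖(T ^ k) x‖) atTop atTop}) :
    IsDistributionallyChaotic T := by
  have hwindow : ∀ (A : Set E), IsOpen A →
      Dense {x : E | ∀ᶠ k in atTop, (T ^ k) x ∈ A} → ∀ m : ℕ,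
      IsOpen {x : E | ∃ j ≥ m, ∀ i ∈ Set.Icc j (j * j), (T ^ i) x ∈ A} ∧
        Dense {x : E | ∃ j ≥ m, ∀ i ∈ Set.Icc j (j * j), (T ^ i) x ∈ A} := by
    intro A hA hd m
    constructor
    · have heq : {x : E | ∃ j ≥ m, ∀ i ∈ Set.Icc j (j * j), (T ^ i) x ∈ A} =
          ⋃ j ≥ m, ⋂ i ∈ Set.Icc j (j * j), (T ^ i : E →L[ℂ] E) ⁻¹' A := by
        ext x; simp
      rw [heq]
      exact isOpen_biUnion fun j _ => (Set.finite_Icc j (j * j)).isOpen_biInter fun i _ =>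
        hA.preimage (T ^ i).continuous
    · refine hd.mono fun x hx => ?_
      obtain ⟨N, hN⟩ := eventually_atTop.1 hx
      exact ⟨max m N, le_max_left _ _, fun i hi => hN i ((le_max_right _ _).trans hi.1)⟩
  have hs : ∀ m : ℕ, _ := fun m : ℕ => hwindow {y | ‖y‖ < 1 / ((m : ℝ) + 1)}
    (isOpen_lt continuous_norm continuous_const)
    (h0.mono fun x hx => by
      have hx' : Tendsto (fun k : ℕ => ‖(T ^ k) x‖) atTop (𝓝 0) := by simpa using Tendsto.norm hx
      exact hx'.eventually_lt_const (by positivity)) m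
  have hl : ∀ m : ℕ, _ := fun m : ℕ => hwindow {y | 1 < ‖y‖}
    (isOpen_lt continuous_const continuous_norm)
    (h1.mono fun x (hx : Tendsto (fun k : ℕ => ‖(T ^ k) x‖) atTop atTop) =>
      hx.eventually_gt_atTop 1) m
  obtain ⟨x, hx⟩ := (dense_iInter_of_isOpen (fun m => (hs m).1.inter (hl m).1) fun m =>
    (hs m).2.inter_of_isOpen_left (hl m).2 (hs m).1).nonempty
  rw [Set.mem_iInter] at hx
  exact isDistributionallyChaotic_of_forall_exists_window (fun m => (hx m).1) fun m => (hx m).2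

/-- A form of the Godefroy-Shapiro criterion. -/
theorem chaos_of_dense_eigenvectorSpan [Nontrivial E] [CompleteSpace E] {T : E →L[ℂ] E}
    (h0 : Dense (eigenvectorSpan T fun μ => ‖μ‖ < 1 : Set E))
    (h1 : Dense (eigenvectorSpan T fun μ => 1 < ‖μ‖ : Set E))
    (hp : Dense (eigenvectorSpan T fun μ => ∃ k > 0, μ ^ k = 1 : Set E)) :
    IsStronglyMixing T ∧ IsDevaneyChaotic T ∧ IsDistributionallyChaotic T ∧
      IsLiYorkeChaotic T := by
  have hmix := isStronglyMixing_of_dense_eigenvectorSpan h0 h1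
  obtain ⟨e, he⟩ := exists_tendsto_norm_pow_apply_atTop h1
  have hdist : IsDistributionallyChaotic T := by
    refine isDistributionallyChaotic_of_dense
      (h0.mono fun x hx => tendsto_pow_apply_of_mem_eigenvectorSpan hx) ?_
    refine Metric.dense_iff.2 fun x r hr => ?_
    -- Unbounded orbits are dense: near `x` choose `u` with orbit tending to 0, then add a small
    -- multiple of `e`, whose orbit escapes to infinity.
    obtain ⟨u, hu, hux⟩ := h0.exists_mem_open Metric.isOpen_ball ⟨x, Metric.mem_ball_self hr⟩
    obtain ⟨c, hc, hcr⟩ := exists_ne_zero_norm_smul_lt e (sub_pos.2 (Metric.mem_ball.1 hux))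
    refine ⟨u + c • e, ?_, ?_⟩
    · rw [Metric.mem_ball]
      calc dist (u + c • e) x ≤ dist (u + c • e) u + dist u x := dist_triangle _ _ _
        _ = ‖c • e‖ + dist u x := by rw [dist_self_add_left]
        _ < r := by linarith
    · have h2 : Tendsto (fun k : ℕ => ‖(T ^ k) (c • e)‖ - ‖(T ^ k) u‖) atTop atTop := by
        refine (tendsto_norm_pow_smul_apply_atTop he hc).atTop_add
          (C := 0) ?_
        simpa using (tendsto_pow_apply_of_mem_eigenvectorSpan hu).norm.neg
      refine tendsto_atTop_mono (fun k => ?_) h2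
      rw [map_add, add_comm]
      exact norm_sub_le_norm_add _ _
  exact ⟨hmix, ⟨hmix.isTransitiveOperator,
    hp.mono fun x hx => mem_periodicPts_of_mem_eigenvectorSpan hx,
    hasSensitiveDependence_of_tendsto_atTop he⟩, hdist, hdist.isLiYorkeChaotic⟩

theorem eigenvectorSpan_le_of_mul_eq_one {S T : E →L[ℂ] E} (h : S * T = 1) {P Q : ℂ → Prop}
    (hPQ : ∀ μ, μ ≠ 0 → P μ → Q μ⁻¹) : eigenvectorSpan T P ≤ eigenvectorSpan S Q := by
  refine Submodule.span_le.2 ?_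
  rintro x ⟨μ, hμ, hx⟩
  have hS : x = μ • S x := by
    rw [← map_smul, ← hx, ← mul_apply_eq_comp, h, one_apply_eq_self]
  -- A left-invertible `T` has no eigenvector for 0, so this case leaves only `x = 0`.
  rcases eq_or_ne μ 0 with rfl | hμ0
  · rw [hS, zero_smul]
    exact zero_mem _
  · exact Submodule.subset_span ⟨μ⁻¹, hPQ μ hμ0 hμ, by
      rw [eq_inv_smul_iff₀ hμ0]
      exact hS.symm⟩

theorem chaos_iff_of_dense_eigenvectorSpan [Nontrivial E] [CompleteSpace E] {S T : E →L[ℂ] E}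
    (h : S * T = 1)
    (h0 : Dense (eigenvectorSpan T fun μ => ‖μ‖ < 1 : Set E))
    (h1 : Dense (eigenvectorSpan T fun μ => 1 < ‖μ‖ : Set E))
    (hp : Dense (eigenvectorSpan T fun μ => ∃ k > 0, μ ^ k = 1 : Set E)) :
    (IsStronglyMixing T ↔ IsStronglyMixing S) ∧ (IsDevaneyChaotic T ↔ IsDevaneyChaotic S) ∧
      (IsDistributionallyChaotic T ↔ IsDistributionallyChaotic S) ∧
      (IsLiYorkeChaotic T ↔ IsLiYorkeChaotic S) := by
  obtain ⟨a1, a2, a3, a4⟩ := chaos_of_dense_eigenvectorSpan h0 h1 hp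
  obtain ⟨b1, b2, b3, b4⟩ := chaos_of_dense_eigenvectorSpan (T := S)
    (h1.mono <| eigenvectorSpan_le_of_mul_eq_one h fun μ _ hμ => by
      rw [norm_inv]; exact inv_lt_one_of_one_lt₀ hμ)
    (h0.mono <| eigenvectorSpan_le_of_mul_eq_one h fun μ hμ0 hμ => by
      rw [norm_inv]; exact (one_lt_inv₀ (norm_pos_iff.2 hμ0)).2 hμ)
    (hp.mono <| eigenvectorSpan_le_of_mul_eq_one h fun μ _ hμ => by
      obtain ⟨k, hk, hμ⟩ := hμ
      exact ⟨k, hk, by rw [inv_pow, hμ, inv_one]⟩)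
  exact ⟨iff_of_true a1 b1, iff_of_true a2 b2, iff_of_true a3 b3, iff_of_true a4 b4⟩

end GodefroyShapiro

/-! ### Eigenvectors of `λ + aBⁿ` and density of their spans. -/

section BackwardShift

/-- The geometric sequences `(1, z, z², …)` with ratio `z ∈ A`, `‖z‖ < 1`. -/
def geometricVectors (A : Set ℂ) : Set SeqL2 :=
  {x | ∃ z ∈ A, ‖z‖ < 1 ∧ ∀ k, x k = z ^ k}

theorem exists_geometricVector {z : ℂ} (hz : ‖z‖ < 1) : ∃ x : SeqL2, ∀ k, x k = z ^ k := by
  have h : Memℓp (fun k : ℕ => z ^ k) 2 := by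
    refine memℓp_gen ?_
    have h2 : ‖z‖ ^ 2 < 1 := pow_lt_one₀ (norm_nonneg z) hz two_ne_zero
    refine (summable_geometric_of_lt_one (by positivity) h2).congr fun k => ?_
    simp only [norm_pow, ENNReal.toReal_ofNat, Real.rpow_ofNat]
    rw [← pow_mul, ← pow_mul, mul_comm]
  exact ⟨⟨_, h⟩, fun k => rfl⟩

/-- If `y` is orthogonal to the span, the power series with coefficients `conj (y k)` vanishes at
the points of `A` in the unit disc. These accumulate at `z₀` inside the disc, so the identity
theorem kills every coefficient. -/
theorem dense_span_geometricVectors {A : Set ℂ} {z₀ : ℂ} (hz₀ : ‖z₀‖ < 1)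
    (hA : ∃ᶠ z in 𝓝[≠] z₀, z ∈ A) :
    Dense (Submodule.span ℂ (geometricVectors A) : Set SeqL2) := by
  rw [Submodule.dense_iff_topologicalClosure_eq_top, Submodule.topologicalClosure_eq_top_iff,
    Submodule.eq_bot_iff]
  intro y hy
  let c : ℕ → ℂ := fun k => starRingEnd ℂ (y k)
  let p : FormalMultilinearSeries ℂ ℂ ℂ := FormalMultilinearSeries.ofScalars ℂ c
  -- The coefficients are bounded by `‖y‖`.
  have hrad : 1 ≤ p.radius := by
    have := p.le_radius_of_bound ‖y‖ (r := 1) fun k => by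
      simpa [p, c, FormalMultilinearSeries.ofScalars_norm] using
        lp.norm_apply_le_norm two_ne_zero y k
    simpa using this
  have hp := p.hasFPowerSeriesOnBall (one_pos.trans_le hrad)
  have hsum : ∀ z ∈ A, ‖z‖ < 1 → p.sum z = 0 := by
    intro z hzA hz
    obtain ⟨x, hx⟩ := exists_geometricVector hz
    have hin : inner ℂ y x = 0 :=
      Submodule.inner_left_of_mem_orthogonal
        (Submodule.subset_span (show x ∈ geometricVectors A from ⟨z, hzA, hz, hx⟩)) hy
    rw [lp.inner_eq_tsum] at hin
    rw [← hin]
    refine (FormalMultilinearSeries.ofScalars_sum_eq c z).trans (tsum_congr fun k => ?_)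
    rw [hx, RCLike.inner_apply, smul_eq_mul, mul_comm]
  have hball : Metric.ball (0 : ℂ) 1 ⊆ Metric.eball 0 p.radius := by
    intro z hz
    rw [Metric.mem_ball, dist_zero_right] at hz
    rw [Metric.mem_eball, edist_zero_right]
    refine lt_of_lt_of_le ?_ hrad
    rw [← ofReal_norm]
    exact ENNReal.ofReal_lt_one.2 hz
  have hzero : Set.EqOn p.sum 0 (Metric.ball (0 : ℂ) 1) := by
    refine AnalyticOnNhd.eqOn_zero_of_preconnected_of_frequently_eq_zero
      (hp.analyticOnNhd.mono hball) (convex_ball _ _).isPreconnected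
      (by simpa using hz₀ : z₀ ∈ _) ?_
    have hev : ∀ᶠ z in 𝓝[≠] z₀, ‖z‖ < 1 :=
      nhdsWithin_le_nhds ((isOpen_lt continuous_norm continuous_const).mem_nhds hz₀)
    exact (hA.and_eventually hev).mono fun z hz => hsum z hz.1 hz.2
  have hp0 : p = 0 := by
    refine HasFPowerSeriesAt.eq_zero (x := 0) (hp.hasFPowerSeriesAt.congr ?_)
    exact eventually_of_mem (Metric.ball_mem_nhds _ one_pos) hzero
  have hc : c = 0 := (FormalMultilinearSeries.ofScalars_series_eq_zero ℂ).1 hp0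
  ext k
  simpa [c] using congrFun hc k

theorem backwardShift_pow_apply (n : ℕ) (x : SeqL2) (k : ℕ) :
    (backwardShift ^ n) x k = x (k + n) := by
  induction n generalizing k with
  | zero => simp
  | succ n ih =>
    rw [pow_succ', mul_apply_eq_comp, backwardShift_apply, ih, add_right_comm,
      add_assoc]

theorem norm_backwardShift_pow_apply_le (n : ℕ) (x : SeqL2) : ‖(backwardShift ^ n) x‖ ≤ ‖x‖ := by
  induction n with
  | zero => simp
  | succ n ih =>
    rw [pow_succ', mul_apply_eq_comp]
    exact (SeqL2.norm_tail_le _).trans ih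

theorem span_geometricVectors_le_eigenvectorSpan (lam a : ℂ) (n : ℕ) (P : ℂ → Prop) :
    Submodule.span ℂ (geometricVectors {z | P (lam + a * z ^ n)}) ≤
      eigenvectorSpan (lam • (1 : SeqL2 →L[ℂ] SeqL2) + a • backwardShift ^ n) P := by
  refine Submodule.span_mono ?_
  rintro x ⟨z, hz, -, hx⟩
  refine ⟨_, hz, ?_⟩
  ext k
  have h1 : ((lam • (1 : SeqL2 →L[ℂ] SeqL2) + a • backwardShift ^ n) x) k
      = lam * x k + a * (backwardShift ^ n) x k := rfl
  have h2 : ((lam + a * z ^ n) • x) k = (lam + a * z ^ n) * x k := rfl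
  rw [h1, h2, backwardShift_pow_apply, hx, hx, pow_add]
  ring

theorem exists_norm_lt_one_add_mul_pow_eq {lam a w : ℂ} {n : ℕ} (hn : n ≠ 0) (ha : a ≠ 0)
    (hw : ‖w - lam‖ < ‖a‖) : ∃ z : ℂ, ‖z‖ < 1 ∧ lam + a * z ^ n = w := by
  obtain ⟨z, hz⟩ := IsAlgClosed.exists_pow_nat_eq ((w - lam) / a) (Nat.pos_of_ne_zero hn)
  refine ⟨z, ?_, ?_⟩
  · have h : ‖z‖ ^ n < 1 := by
      rw [← norm_pow, hz, norm_div]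
      exact (div_lt_one (norm_pos_iff.2 ha)).2 hw
    exact (pow_lt_one_iff_of_nonneg (norm_nonneg z) hn).1 h
  · rw [hz, mul_div_cancel₀ _ ha]
    ring

/-- Open mapping theorem: the map is not locally constant, since `z ^ n = z₀ ^ n` has finitely many
roots. -/
theorem nhds_le_map_add_mul_pow {lam a : ℂ} {n : ℕ} (hn : n ≠ 0) (ha : a ≠ 0) (z₀ : ℂ) :
    𝓝 (lam + a * z₀ ^ n) ≤ map (fun z => lam + a * z ^ n) (𝓝 z₀) := by
  have han : AnalyticAt ℂ (fun z : ℂ => lam + a * z ^ n) z₀ := by fun_prop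
  refine han.eventually_constant_or_nhds_le_map_nhds.resolve_left fun hconst => ?_
  have hroots : {z : ℂ | z ^ n = z₀ ^ n}.Finite := by
    refine ((Polynomial.nthRoots n (z₀ ^ n)).toFinset.finite_toSet).subset fun z hz => ?_
    simpa [Polynomial.mem_nthRoots (Nat.pos_of_ne_zero hn)] using hz
  refine Set.Infinite.mono (fun z hz => ?_) (infinite_of_mem_nhds z₀ hconst) hroots
  exact mul_left_cancel₀ ha (add_left_cancel hz)

theorem dense_eigenvectorSpan_of_frequently {lam a w : ℂ} {n : ℕ} (hn : n ≠ 0) (ha : a ≠ 0)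
    (hw : ‖w - lam‖ < ‖a‖) {P : ℂ → Prop} (hP : ∃ᶠ μ in 𝓝[≠] w, P μ) :
    Dense (eigenvectorSpan (lam • (1 : SeqL2 →L[ℂ] SeqL2) + a • backwardShift ^ n) P :
      Set SeqL2) := by
  obtain ⟨z₀, hz₀, rfl⟩ := exists_norm_lt_one_add_mul_pow_eq hn ha hw
  refine (dense_span_geometricVectors hz₀ ?_).mono
    (span_geometricVectors_le_eigenvectorSpan lam a n P)
  rw [frequently_nhdsWithin_iff] at hP ⊢
  have h := hP.filter_mono (nhds_le_map_add_mul_pow hn ha z₀)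
  rw [frequently_map] at h
  exact h.mono fun z hz => ⟨hz.1, fun hzz => hz.2 (by rw [hzz]; rfl)⟩

/-- Rational angles are dense, and `s ↦ exp (2πis)` has nonzero derivative, so it carries punctured
neighbourhoods of `t` to punctured neighbourhoods of `w`. -/
theorem frequently_rootOfUnity {w : ℂ} (hw : ‖w‖ = 1) :
    ∃ᶠ μ in 𝓝[≠] w, ∃ k > 0, μ ^ k = 1 := by
  obtain ⟨t, rfl⟩ : ∃ t : ℝ, Complex.exp (t * (2 * Real.pi * Complex.I)) = w := by
    refine ⟨w.arg / (2 * Real.pi), ?_⟩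
    have h := Complex.norm_mul_exp_arg_mul_I w
    rw [hw, Complex.ofReal_one, one_mul] at h
    have hpi : (Real.pi : ℂ) ≠ 0 := Complex.ofReal_ne_zero.2 Real.pi_ne_zero
    rw [← h]
    push_cast
    congr 1
    rw [h]
    field_simp
  have hderiv : HasDerivAt (fun s : ℝ => Complex.exp (s * (2 * Real.pi * Complex.I)))
      (Complex.exp (t * (2 * Real.pi * Complex.I)) * (1 * (2 * Real.pi * Complex.I))) t :=
    ((Complex.ofRealCLM.hasDerivAt (x := t)).mul_const _).cexp
  have hne : Complex.exp (t * (2 * Real.pi * Complex.I)) * (1 * (2 * Real.pi * Complex.I)) ≠ 0 := by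
    rw [one_mul]
    exact mul_ne_zero (Complex.exp_ne_zero _) Complex.two_pi_I_ne_zero
  have hrat : ∃ᶠ s in 𝓝[≠] t, s ∈ Set.range ((↑) : ℚ → ℝ) := by
    rw [← mem_closure_ne_iff_frequently_within]
    have := (Rat.denseRange_cast (𝕜 := ℝ)).sdiff_singleton t
    exact this t
  refine (hderiv.tendsto_nhdsNE hne).frequently (hrat.mono ?_)
  rintro _ ⟨q, rfl⟩
  refine ⟨q.den, q.den_pos, ?_⟩
  rw [← Complex.exp_nat_mul, ← Complex.exp_int_mul_two_pi_mul_I q.num]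
  congr 1
  have hq : (q.den : ℂ) * q = q.num := by exact_mod_cast Rat.den_mul_eq_num q
  rw [← hq, Complex.ofReal_ratCast]
  ring

theorem exists_norm_eq_one_norm_sub_lt {lam a : ℂ} (hlam : lam ≠ 0)
    (h1 : 1 < ‖lam‖ + ‖a‖) (h2 : ‖lam‖ < 1 + ‖a‖) :
    ∃ w : ℂ, ‖w‖ = 1 ∧ ‖w - lam‖ < ‖a‖ := by
  have hl : 0 < ‖lam‖ := norm_pos_iff.2 hlam
  -- The point of the unit circle nearest to `lam`, at distance `|1 - ‖lam‖|`.
  refine ⟨(‖lam‖⁻¹ : ℝ) • lam, ?_, ?_⟩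
  · rw [norm_smul, norm_inv, norm_norm, inv_mul_cancel₀ hl.ne']
  · have : (‖lam‖⁻¹ : ℝ) • lam - lam = (‖lam‖⁻¹ - 1 : ℝ) • lam := by rw [sub_smul, one_smul]
    rw [this, norm_smul, ← norm_norm lam, ← norm_mul, norm_norm, sub_mul, inv_mul_cancel₀ hl.ne',
      Real.norm_eq_abs, abs_lt]
    constructor <;> linarith

theorem frequently_nhdsNE_norm_lt_one {w : ℂ} (hw : ‖w‖ = 1) : ∃ᶠ μ in 𝓝[≠] w, ‖μ‖ < 1 := by
  have h : w ∈ closure (Metric.ball (0 : ℂ) 1) := by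
    rw [closure_ball _ one_ne_zero]
    simp [hw]
  change ∃ᶠ μ in 𝓝[≠] w, μ ∈ {μ : ℂ | ‖μ‖ < 1}
  rw [← mem_closure_ne_iff_frequently_within]
  refine closure_mono (fun z hz => ?_) h
  rw [Metric.mem_ball, dist_zero_right] at hz
  exact ⟨hz, fun hzw => by rw [Set.mem_singleton_iff.1 hzw, hw] at hz; exact hz.false⟩

theorem frequently_nhdsNE_one_lt_norm {w : ℂ} (hw : ‖w‖ = 1) : ∃ᶠ μ in 𝓝[≠] w, 1 < ‖μ‖ := by
  have h : w ∈ closure (Metric.closedBall (0 : ℂ) 1)ᶜ := by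
    rw [closure_compl, interior_closedBall _ one_ne_zero]
    simp [hw]
  change ∃ᶠ μ in 𝓝[≠] w, μ ∈ {μ : ℂ | 1 < ‖μ‖}
  rw [← mem_closure_ne_iff_frequently_within]
  refine closure_mono (fun z hz => ?_) h
  rw [Set.mem_compl_iff, Metric.mem_closedBall, dist_zero_right, not_le] at hz
  exact ⟨hz, fun hzw => by rw [Set.mem_singleton_iff.1 hzw, hw] at hz; exact hz.false⟩

end BackwardShift

/-! ### Passing norm inequalities to the inverse. -/

section Inverse

variable {E : Type*} [NormedAddCommGroup E] [NormedSpace ℂ E]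

theorem chaos_iff_of_norm_le [Nontrivial E] {S T : E →L[ℂ] E} (h : T * S = 1)
    (hT : ∀ x, ‖T x‖ ≤ ‖x‖) :
    (IsStronglyMixing T ↔ IsStronglyMixing S) ∧ (IsDevaneyChaotic T ↔ IsDevaneyChaotic S) ∧
      (IsDistributionallyChaotic T ↔ IsDistributionallyChaotic S) ∧
      (IsLiYorkeChaotic T ↔ IsLiYorkeChaotic S) := by
  have hS : ∀ x, ‖x‖ ≤ ‖S x‖ := fun x => by
    have := hT (S x)
    rwa [← mul_apply_eq_comp, h, one_apply_eq_self] at this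
  exact chaos_iff_of_not (not_isTransitiveOperator_of_norm_le hT)
    (not_isLiYorkeChaotic_of_norm_le hT) (not_isTransitiveOperator_of_le_norm hS)
    (not_isLiYorkeChaotic_of_le_norm hS)

theorem chaos_iff_of_le_norm [Nontrivial E] {S T : E →L[ℂ] E} (h : T * S = 1)
    (hT : ∀ x, ‖x‖ ≤ ‖T x‖) :
    (IsStronglyMixing T ↔ IsStronglyMixing S) ∧ (IsDevaneyChaotic T ↔ IsDevaneyChaotic S) ∧
      (IsDistributionallyChaotic T ↔ IsDistributionallyChaotic S) ∧
      (IsLiYorkeChaotic T ↔ IsLiYorkeChaotic S) := by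
  have hS : ∀ x, ‖S x‖ ≤ ‖x‖ := fun x => by
    have := hT (S x)
    rwa [← mul_apply_eq_comp, h, one_apply_eq_self] at this
  exact chaos_iff_of_not (not_isTransitiveOperator_of_le_norm hT)
    (not_isLiYorkeChaotic_of_le_norm hT) (not_isTransitiveOperator_of_norm_le hS)
    (not_isLiYorkeChaotic_of_norm_le hS)

end Inverse

instance SeqL2.instNontrivial : Nontrivial SeqL2 := by
  obtain ⟨x, hx⟩ := exists_geometricVector (z := 0) (by simp)
  -- For `z = 0` the coordinate of index 0 is `0 ^ 0 = 1`.
  exact ⟨x, 0, fun h => by simpa [h] using hx 0⟩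

theorem corollary6 (lam a : ℂ) (n : ℕ) (hlam : lam ≠ 0) (ha : a ≠ 0)
    (hinv : IsUnit (lam • (1 : SeqL2 →L[ℂ] SeqL2) + a • backwardShift ^ n)) :
    (IsStronglyMixing (lam • (1 : SeqL2 →L[ℂ] SeqL2) + a • backwardShift ^ n) ↔
      IsStronglyMixing (Ring.inverse (lam • (1 : SeqL2 →L[ℂ] SeqL2) + a • backwardShift ^ n))) ∧
    (IsDevaneyChaotic (lam • (1 : SeqL2 →L[ℂ] SeqL2) + a • backwardShift ^ n) ↔
      IsDevaneyChaotic (Ring.inverse (lam • (1 : SeqL2 →L[ℂ] SeqL2) + a • backwardShift ^ n))) ∧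
    (IsDistributionallyChaotic (lam • (1 : SeqL2 →L[ℂ] SeqL2) + a • backwardShift ^ n) ↔
      IsDistributionallyChaotic
        (Ring.inverse (lam • (1 : SeqL2 →L[ℂ] SeqL2) + a • backwardShift ^ n))) ∧
    (IsLiYorkeChaotic (lam • (1 : SeqL2 →L[ℂ] SeqL2) + a • backwardShift ^ n) ↔
      IsLiYorkeChaotic
        (Ring.inverse (lam • (1 : SeqL2 →L[ℂ] SeqL2) + a • backwardShift ^ n))) := by
  have hST := Ring.inverse_mul_cancel _ hinv
  have hTS := Ring.mul_inverse_cancel _ hinv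
  rcases Nat.eq_zero_or_pos n with rfl | hn
  · have hT : ∀ x, ‖(lam • (1 : SeqL2 →L[ℂ] SeqL2) + a • backwardShift ^ 0) x‖
        = ‖lam + a‖ * ‖x‖ := fun x => by
      rw [pow_zero, ← add_smul, ← norm_smul]
      rfl
    rcases le_total ‖lam + a‖ 1 with h | h
    · exact chaos_iff_of_norm_le hTS fun x => by
        rw [hT]
        exact mul_le_of_le_one_left (norm_nonneg x) h
    · exact chaos_iff_of_le_norm hTS fun x => by
        rw [hT]
        exact le_mul_of_one_le_left (norm_nonneg x) h
  have hT : ∀ x, (lam • (1 : SeqL2 →L[ℂ] SeqL2) + a • backwardShift ^ n) x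
      = lam • x + a • (backwardShift ^ n) x := fun x => rfl
  have hB : ∀ x, ‖a • (backwardShift ^ n) x‖ ≤ ‖a‖ * ‖x‖ := fun x => by
    rw [norm_smul]
    exact mul_le_mul_of_nonneg_left (norm_backwardShift_pow_apply_le n x) (norm_nonneg a)
  rcases le_or_gt (‖lam‖ + ‖a‖) 1 with h1 | h1
  · refine chaos_iff_of_norm_le hTS fun x => ?_
    rw [hT]
    calc ‖lam • x + a • (backwardShift ^ n) x‖
        ≤ ‖lam • x‖ + ‖a • (backwardShift ^ n) x‖ := norm_add_le _ _
      _ ≤ (‖lam‖ + ‖a‖) * ‖x‖ := by rw [norm_smul lam, add_mul]; gcongr; exact hB x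
      _ ≤ ‖x‖ := mul_le_of_le_one_left (norm_nonneg x) h1
  rcases le_or_gt (1 + ‖a‖) ‖lam‖ with h2 | h2
  · refine chaos_iff_of_le_norm hTS fun x => ?_
    rw [hT]
    calc ‖x‖ ≤ (‖lam‖ - ‖a‖) * ‖x‖ := le_mul_of_one_le_left (norm_nonneg x) (by linarith)
      _ ≤ ‖lam • x‖ - ‖a • (backwardShift ^ n) x‖ := by
        rw [norm_smul lam, sub_mul]; gcongr; exact hB x
      _ ≤ ‖lam • x + a • (backwardShift ^ n) x‖ := norm_sub_le_norm_add _ _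
  -- The remaining case: the eigenvalue disc meets the unit circle.
  obtain ⟨w, hw, hwa⟩ := exists_norm_eq_one_norm_sub_lt hlam h1 h2
  exact chaos_iff_of_dense_eigenvectorSpan hST
    (dense_eigenvectorSpan_of_frequently hn.ne' ha hwa (frequently_nhdsNE_norm_lt_one hw))
    (dense_eigenvectorSpan_of_frequently hn.ne' ha hwa (frequently_nhdsNE_one_lt_norm hw))
    (dense_eigenvectorSpan_of_frequently hn.ne' ha hwa (frequently_rootOfUnity hw))
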